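/- Let $k$ be a field. A variety over $k$ is a separated scheme of finite type over $k$. The Grothendieck ring $K_0(\mathrm{Var}_k)$ is the abelian group generated by the isomorphism classes $[X]$ of varieties over $k$, with the relations $[X]=[X\setminus Y]+[Y]$ for every closed subvariety $Y\subset X$, and with the product $[X]\cdot[Z]=[X\times_k Z]$. (It is the same ring if varieties are required to be reduced, since $[X]=[X_{\mathrm{red}}]$.) Let $\mathbb{L}=[\mathbb{A}^1_k]$ and $1=[\operatorname{Spec} k]$. Let $L/k$ be a finite Galois extension, let $1\le d\le n$ be integers, and let $X\subset\mathbb{P}^n_k$ be a hypersurface of degree $d$, that is, a closed subscheme whose underlying set is $V(f)$ for some nonzero homogeneous polynomial $f\in k[x_0,\dots,x_n]$ of degree $d$. Suppose that $X\times_k L\subset\mathbb{P}^n_L$ is a union of $d$ hyperplanes, that is, its underlying set is $V(h_1\cdots h_d)$ for some homogeneous $h_1,\dots,h_d\in L[x_0,\dots,x_n]$ of degree $1$. Then $$[X]\equiv 1 \bmod \mathbb{L}\quad\text{in } K_0(\mathrm{Var}_k),\qquad\text{and}\qquad X(k)\neq\emptyset .$$ -/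

import Mathlib

open CategoryTheory CategoryTheory.Limits AlgebraicGeometry

universe u

namespace KZeroVar

section Varieties

variable (k : Type u) [Field k]

/-- `X ⟶ Spec k` is a variety: it is separated and of finite type. Following a common convention,
reducedness is not required; since `[X] = [X_red]` follows from the scissor relations,
this does not change the Grothendieck ring, and it makes the fibre product a variety over every
field `k`, perfect or not. -/
def IsVariety : ObjectProperty (Over (Spec (.of k))) := fun X =>
  IsSeparated X.hom ∧ LocallyOfFiniteType X.hom ∧ QuasiCompact X.hom

/-- The category of varieties over `k` (a full subcategory of the category of `k`-schemes). -/
abbrev Variety : Type (u + 1) := (IsVariety k).FullSubcategory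

/-- `Spec k` is a variety and `X ×ₖ Y` is a variety if `X` and `Y` are. Here `X ⊗ Y` in the category
of `k`-schemes is the fibre product over `Spec k`. -/
instance : (IsVariety k).IsMonoidal where
  prop_unit := by
    refine ⟨?_, ?_, ?_⟩ <;> dsimp <;> infer_instance
  prop_tensor X Y hX hY := by
    obtain ⟨_, _, _⟩ := hX
    obtain ⟨_, _, _⟩ := hY
    refine ⟨?_, ?_, ?_⟩ <;> dsimp <;> infer_instance

/-- The free abelian group on isomorphism classes of varieties over `k`, as a commutative ring with
the product `{X} * {Y} = {X ×ₖ Y}`: the monoid ring over `ℤ` of the commutative monoid of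
isomorphism classes of varieties. -/
abbrev FreeRing : Type (u + 1) := MonoidAlgebra ℤ (Skeleton (Variety k))

variable {k} in
/-- The basis element of the isomorphism class of `X`. -/
noncomputable def freeClass (X : Variety k) : FreeRing k :=
  MonoidAlgebra.of ℤ (Skeleton (Variety k)) (toSkeleton X)

/-- The scissor relators `{X} - ({U} + {Y})`, where `Y` is a closed subscheme of `X` and
`U = X \ Y` is its open complement. -/
def scissorRelators : Set (FreeRing k) :=
  {r | ∃ (X Y U : Variety k) (i : Y ⟶ X) (j : U ⟶ X),
    IsClosedImmersion i.hom.left ∧ IsOpenImmersion j.hom.left ∧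
    Set.range j.hom.left = (Set.range i.hom.left)ᶜ ∧
    r = freeClass X - (freeClass U + freeClass Y)}

/-- The Grothendieck ring `K₀(Var_k)`. Multiplying a scissor relator by `{Z}` gives the scissor
relator of `Z ×ₖ Y ⊆ Z ×ₖ X`, so the ideal generated by the scissor relators is the additive
subgroup they generate. -/
abbrev KZero : Type (u + 1) := FreeRing k ⧸ Ideal.span (scissorRelators k)

variable {k} in
/-- The class `[X]` of a variety in `K₀(Var_k)`. -/
noncomputable def cls (X : Variety k) : KZero k :=
  Ideal.Quotient.mk (Ideal.span (scissorRelators k)) (freeClass X)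

/-- The affine line over `k` as a variety. -/
noncomputable def affineLine : Variety k where
  obj := Over.mk (𝔸(PUnit.{u + 1}; Spec (.of k)) ↘ Spec (.of k))
  property := by
    refine ⟨?_, ?_, ?_⟩ <;> dsimp <;> infer_instance

/-- The class `𝕃 = [𝔸¹]`. -/
noncomputable def lefschetz : KZero k := cls (affineLine k)

variable {k} in
/-- The set `X(k)` of `k`-rational points: sections of the structure morphism `X ⟶ Spec k`. -/
abbrev RationalPoints (X : Variety k) : Type u := Over.mk (𝟙 (Spec (.of k))) ⟶ X.obj

end Varieties

section ProjectiveSpace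

/-- The grading of `k[x₀, …, xₙ]` by degree. -/
abbrev grading (k : Type u) [Field k] (n : ℕ) : ℕ → Submodule k (MvPolynomial (Fin (n + 1)) k) :=
  MvPolynomial.homogeneousSubmodule (Fin (n + 1)) k

noncomputable instance (k : Type u) [Field k] (n : ℕ) : GradedAlgebra (grading k n) :=
  MvPolynomial.gradedAlgebra

/-- The structure morphism `ℙⁿ_k = Proj k[x₀, …, xₙ] ⟶ Spec k`. -/
noncomputable def projToSpec (k : Type u) [Field k] (n : ℕ) :
    Proj (grading k n) ⟶ Spec (.of k) :=
  Proj.toSpecZero (grading k n) ≫ Spec.map (CommRingCat.ofHom (algebraMap k (grading k n 0)))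

/-- Projective space `ℙⁿ_k` as a scheme over `k`. -/
noncomputable abbrev projSpace (k : Type u) [Field k] (n : ℕ) : Over (Spec (.of k)) :=
  Over.mk (projToSpec k n)

/-- The closed set `V(f) ⊆ ℙⁿ_k`: the homogeneous primes (not containing the irrelevant ideal)
that contain `f`. -/
def vanishingSet {k : Type u} [Field k] {n : ℕ} (f : MvPolynomial (Fin (n + 1)) k) :
    Set (Proj (grading k n)) :=
  {x | f ∈ x.asHomogeneousIdeal}

variable (k L : Type u) [Field k] [Field L] [Algebra k L] (n : ℕ)

/-- The extension of scalars `k[x₀, …, xₙ] → L[x₀, …, xₙ]` as a graded ring homomorphism. -/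
noncomputable def gradedMap : GradedRingHom (grading k n) (grading L n) where
  toRingHom := MvPolynomial.map (algebraMap k L)
  map_mem h := MvPolynomial.IsHomogeneous.map h _

lemma irrelevant_le_map_gradedMap :
    HomogeneousIdeal.irrelevant (grading L n) ≤
      (HomogeneousIdeal.irrelevant (grading k n)).map (gradedMap k L n) := by
  intro p hp
  have hp0 : MvPolynomial.constantCoeff p = 0 := by
    have h := (HomogeneousIdeal.mem_irrelevant_iff _ _).mp hp
    have e : ((DirectSum.decompose (grading L n) p 0 : grading L n 0) :
        MvPolynomial (Fin (n + 1)) L) = MvPolynomial.homogeneousComponent 0 p :=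
      MvPolynomial.decomposition.decompose'_apply p 0
    rw [GradedRing.proj_apply, e, MvPolynomial.homogeneousComponent_zero] at h
    simpa [MvPolynomial.constantCoeff_eq] using h
  have hX : ∀ i, MvPolynomial.X i ∈
      (HomogeneousIdeal.irrelevant (grading k n)).map (gradedMap k L n) := by
    intro i
    have h : (MvPolynomial.X i : MvPolynomial (Fin (n + 1)) k) ∈
        HomogeneousIdeal.irrelevant (grading k n) := by
      rw [HomogeneousIdeal.mem_irrelevant_iff, GradedRing.proj_apply,
        DirectSum.decompose_of_mem_ne (grading k n) (MvPolynomial.isHomogeneous_X k i) one_ne_zero]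
    have h' := Ideal.mem_map_of_mem (gradedMap k L n) h
    have e : gradedMap k L n (MvPolynomial.X i) = MvPolynomial.X i := MvPolynomial.map_X _ _
    rwa [e] at h'
  have hp' : p ∈ Ideal.span (MvPolynomial.X '' (Set.univ : Set (Fin (n + 1)))) := by
    rw [MvPolynomial.mem_ideal_span_X_image]
    intro m hm
    by_contra! hc
    have : m = 0 := Finsupp.ext fun i => hc i (Set.mem_univ i)
    subst this
    exact MvPolynomial.mem_support_iff.mp hm hp0
  refine (Ideal.span_le.mpr ?_ :
    Ideal.span (MvPolynomial.X '' (Set.univ : Set (Fin (n + 1)))) ≤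
      ((HomogeneousIdeal.irrelevant (grading k n)).map (gradedMap k L n)).toIdeal) hp'
  rintro _ ⟨i, -, rfl⟩
  exact hX i

/-- The projection `ℙⁿ_L ⟶ ℙⁿ_k` induced by the inclusion of homogeneous coordinate rings,
which exhibits `ℙⁿ_L` as the base change of `ℙⁿ_k` along `Spec L ⟶ Spec k`. -/
noncomputable def projBaseChange : Proj (grading L n) ⟶ Proj (grading k n) :=
  Proj.map (gradedMap k L n) (irrelevant_le_map_gradedMap k L n)

end ProjectiveSpace

end KZeroVar

open KZeroVar

/-!
Over `L`, the equation of `X` divides a power of a product of `d ≤ n` linear forms in `n + 1`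
variables (`exists_dvd_pow_of_vanishingSet_subset`), and these forms have a common zero `v ≠ 0` in
`Lⁿ⁺¹`. A product of linear forms is invariant under translation along a common zero of the forms,
and so is every divisor of it, for degree reasons (`translate_eq_C_of_dvd`). The vectors along which
`f` is invariant form an additive group that is stable under the Galois group, so the trace of a
suitable multiple of `v` is a nonzero vector over `k` along which `f` is invariant
(`exists_translate_eq_C`). Hence `X` is a cone with a `k`-rational vertex: in suitable linear
coordinates over `k`, the polynomial `f` does not involve `y₀` (`exists_coordChange`).

Such a cone is stratified by the locally closed subsets `y₁ = … = yₘ = 0`, `yₘ₊₁ ≠ 0`, for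
`0 ≤ m < n`, and by the vertex `y₁ = … = yₙ = 0`. The former lie in affine charts in which neither
`f` nor the other equations involve `y₀`, so they are products with `𝔸¹` and their classes are
divisible by `𝕃` (`lefschetz_dvd_cls_of_cylinder`). The vertex has class `1` and is a rational
point (`cls_eq_one_of_vertex`). Nilpotents play no role, because two closed subschemes with the same
underlying set have the same class (`cls_eq_of_range_eq`).
-/

namespace KZeroVar

/-! ### Classes in the Grothendieck ring -/

section Classes

variable {k : Type u} [Field k]

lemma cls_eq_of_iso {X Y : Variety k} (e : X.obj ≅ Y.obj) : cls X = cls Y := by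
  have h : toSkeleton X = toSkeleton Y :=
    toSkeleton_eq_toSkeleton_iff.mpr ⟨ObjectProperty.isoMk _ e⟩
  rw [cls, cls, freeClass, freeClass, h]

lemma cls_tensor (X Y : Variety k) : cls (MonoidalCategoryStruct.tensorObj X Y) = cls X * cls Y := by
  simp only [cls, freeClass, Skeleton.toSkeleton_tensorObj, map_mul]

lemma cls_unit : cls (MonoidalCategoryStruct.tensorUnit (Variety k)) = 1 := by
  rw [cls, freeClass, ← Skeleton.one_eq, map_one, map_one]

/-- The scissor relation, for varieties given as schemes over `k`. -/
lemma cls_eq_add {X Y U : Variety k} (i : Y.obj ⟶ X.obj) (j : U.obj ⟶ X.obj)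
    [IsClosedImmersion i.left] [IsOpenImmersion j.left]
    (h : Set.range j.left = (Set.range i.left)ᶜ) : cls X = cls U + cls Y := by
  rw [cls, cls, cls, ← map_add, Ideal.Quotient.eq]
  exact Ideal.subset_span ⟨X, Y, U, ObjectProperty.homMk i, ObjectProperty.homMk j,
    ‹_›, ‹_›, h, rfl⟩

lemma cls_eq_zero_of_isEmpty (X : Variety k) [IsEmpty X.obj.left] : cls X = 0 := by
  have h := cls_eq_add (X := X) (Y := X) (U := X) (𝟙 _) (𝟙 _) (by
    ext x; exact isEmptyElim x)
  simpa using h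

/-- A scheme with an immersion over `k` into a variety is a variety. -/
lemma isVariety_of_immersion {S : Over (Spec (.of k))} (X : Variety k) (i : S ⟶ X.obj)
    [IsImmersion i.left] : IsVariety k S := by
  obtain ⟨_, _, _⟩ := X.property
  have : CompactSpace X.obj.left := by
    exact (quasiCompact_iff_compactSpace (f := X.obj.hom)).mp inferInstance
  have : IsLocallyNoetherian X.obj.left := LocallyOfFiniteType.isLocallyNoetherian X.obj.hom
  have : IsNoetherian X.obj.left := {}
  have : TopologicalSpace.NoetherianSpace S.left :=
    i.left.isEmbedding.isInducing.noetherianSpace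
  unfold IsVariety
  rw [← Over.w i]
  exact ⟨inferInstance, inferInstance, inferInstance⟩

/-- The class of a variety only depends on its reduction. -/
lemma cls_eq_of_surjective {X Y : Variety k} (i : Y.obj ⟶ X.obj)
    [IsClosedImmersion i.left] [Surjective i.left] : cls Y = cls X := by
  let U : Over (Spec (.of k)) := Over.mk (Scheme.emptyTo _)
  let j : U ⟶ X.obj := Over.homMk (Scheme.emptyTo _)
  have hE : IsEmpty U.left := inferInstanceAs (IsEmpty (∅ : Scheme))
  have : IsOpenImmersion j.left := inferInstanceAs (IsOpenImmersion (Scheme.emptyTo _))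
  have hU : IsVariety k U := isVariety_of_immersion X j
  rw [cls_eq_add (U := ⟨U, hU⟩) i j, @cls_eq_zero_of_isEmpty _ _ ⟨U, hU⟩ hE, zero_add]
  rw [(Surjective.surj (f := i.left)).range_eq, Set.compl_univ, Set.range_eq_empty]

/-- Two closed subschemes with the same underlying set have the same class. -/
lemma cls_eq_of_range_eq {W : Over (Spec (.of k))} {X Y : Variety k} (i : X.obj ⟶ W)
    (j : Y.obj ⟶ W) [IsClosedImmersion i.left] [IsClosedImmersion j.left]
    (h : Set.range i.left = Set.range j.left) : cls X = cls Y := by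
  let Z : Over (Spec (.of k)) := Over.mk (pullback.fst i.left j.left ≫ X.obj.hom)
  have : Surjective (pullback.fst i.left j.left) := ⟨by
    rw [← Set.range_eq_univ, Scheme.Pullback.range_fst, ← h, Set.preimage_range]⟩
  have : Surjective (pullback.snd i.left j.left) := ⟨by
    rw [← Set.range_eq_univ, Scheme.Pullback.range_snd, h, Set.preimage_range]⟩
  let a : Z ⟶ X.obj := Over.homMk (pullback.fst i.left j.left)
  let b : Z ⟶ Y.obj := Over.homMk (pullback.snd i.left j.left) (by
    rw [← Over.w j, ← pullback.condition_assoc, Over.w i]; rfl)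
  have : IsClosedImmersion a.left := inferInstanceAs (IsClosedImmersion (pullback.fst _ _))
  have : IsClosedImmersion b.left := inferInstanceAs (IsClosedImmersion (pullback.snd _ _))
  have : Surjective a.left := ‹Surjective (pullback.fst i.left j.left)›
  have : Surjective b.left := ‹Surjective (pullback.snd i.left j.left)›
  have hZ : IsVariety k Z := isVariety_of_immersion X a
  rw [← cls_eq_of_surjective (Y := ⟨Z, hZ⟩) a, cls_eq_of_surjective (Y := ⟨Z, hZ⟩) b]

/-- Every closed subset of a variety underlies a closed subvariety. -/
lemma exists_closed_subvariety (X : Variety k) {s : Set X.obj.left} (hs : IsClosed s) :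
    ∃ (Y : Variety k) (i : Y.obj ⟶ X.obj), IsClosedImmersion i.left ∧ Set.range i.left = s := by
  let I := Scheme.IdealSheafData.vanishingIdeal ⟨s, hs⟩
  let Y : Over (Spec (.of k)) := Over.mk (I.subschemeι ≫ X.obj.hom)
  let i : Y ⟶ X.obj := Over.homMk I.subschemeι
  have : IsClosedImmersion i.left := inferInstanceAs (IsClosedImmersion I.subschemeι)
  refine ⟨⟨Y, isVariety_of_immersion X i⟩, i, this, ?_⟩
  change Set.range I.subschemeι = s
  rw [Scheme.IdealSheafData.range_subschemeι, Scheme.IdealSheafData.coe_support_vanishingIdeal]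
  rfl

end Classes

/-! ### Affine varieties and cylinders -/

section Affine

variable (k : Type u) [Field k]

/-- `Spec R` as a scheme over `k`, for a `k`-algebra `R`. -/
noncomputable abbrev specOver (R : Type u) [CommRing R] [Algebra k R] : Over (Spec (.of k)) :=
  Over.mk (Spec.map (CommRingCat.ofHom (algebraMap k R)))

lemma isVariety_specOver (R : Type u) [CommRing R] [Algebra k R] [h : Algebra.FiniteType k R] :
    IsVariety k (specOver k R) := by
  have : LocallyOfFiniteType (Spec.map (CommRingCat.ofHom (algebraMap k R))) := by
    rw [HasRingHomProperty.Spec_iff (P := @LocallyOfFiniteType)]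
    exact (RingHom.finiteType_algebraMap (A := k) (B := R)).mpr h
  exact ⟨inferInstanceAs (IsSeparated (Spec.map _)), this,
    inferInstanceAs (QuasiCompact (Spec.map _))⟩

variable {k}

/-- The morphism of `k`-schemes given by a homomorphism of `k`-algebras. -/
noncomputable abbrev specOverMap {R S : Type u} [CommRing R] [Algebra k R] [CommRing S]
    [Algebra k S] (φ : R →ₐ[k] S) : specOver k S ⟶ specOver k R :=
  Over.homMk (Spec.map (CommRingCat.ofHom φ.toRingHom)) (by
    simp only [Over.mk_hom, ← Spec.map_comp, ← CommRingCat.ofHom_comp]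
    congr 2
    exact φ.comp_algebraMap)

lemma isClosedImmersion_specOverMap {R S : Type u} [CommRing R] [Algebra k R] [CommRing S]
    [Algebra k S] (φ : R →ₐ[k] S) (h : Function.Surjective φ) :
    IsClosedImmersion (specOverMap φ).left :=
  IsClosedImmersion.spec_of_surjective _ h

lemma range_specOverMap {R S : Type u} [CommRing R] [Algebra k R] [CommRing S]
    [Algebra k S] (φ : R →ₐ[k] S) (h : Function.Surjective φ) :
    Set.range (specOverMap φ).left =
      {x : PrimeSpectrum R | RingHom.ker φ ≤ x.asIdeal} :=
  range_comap_of_surjective _ φ.toRingHom h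

/-- `𝔸¹ × Spec B` is the spectrum of the polynomial ring over `B`. -/
lemma nonempty_affineLine_tensor_iso (B : Type u) [CommRing B] [Algebra k B] :
    Nonempty (MonoidalCategoryStruct.tensorObj (affineLine k).obj (specOver k B) ≅
      specOver k (MvPolynomial PUnit.{u + 1} B)) := by
  let g := CommRingCat.ofHom (algebraMap k B)
  let e := (AffineSpace.isPullback_map (n := PUnit.{u + 1}) (Spec.map g)).isoPullback
  have h1 : Spec.map (CommRingCat.ofHom (algebraMap k (MvPolynomial PUnit.{u + 1} B))) =
      Spec.map (CommRingCat.ofHom MvPolynomial.C) ≫ Spec.map g := by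
    rw [← Spec.map_comp, ← CommRingCat.ofHom_comp]
    rfl
  have h2 : (AffineSpace.SpecIso PUnit.{u + 1} (.of B)).hom ≫
      Spec.map (CommRingCat.ofHom MvPolynomial.C) = 𝔸(PUnit.{u + 1}; Spec (.of B)) ↘ _ := by
    rw [← AffineSpace.SpecIso_inv_over, Iso.hom_inv_id_assoc]
  have h3 : (e.symm ≪≫ AffineSpace.SpecIso PUnit.{u + 1} (.of B)).hom ≫
      Spec.map (CommRingCat.ofHom (algebraMap k (MvPolynomial PUnit.{u + 1} B))) =
      pullback.fst _ _ ≫ (𝔸(PUnit.{u + 1}; Spec (.of k)) ↘ _) := by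
    rw [h1, Iso.trans_hom, Category.assoc, reassoc_of% h2, Iso.symm_hom,
      Iso.inv_comp_eq, ← AffineSpace.map_over]
    exact (IsPullback.isoPullback_hom_fst_assoc _ _).symm
  exact ⟨Over.isoMk (e.symm ≪≫ AffineSpace.SpecIso PUnit.{u + 1} (.of B)) h3⟩

/-- A variety with the underlying set of a closed subscheme of the form `𝔸¹ × Spec B` has class
`𝕃 * [Spec B]`. -/
lemma cls_eq_lefschetz_mul {P B : Type u} [CommRing P] [Algebra k P] [CommRing B] [Algebra k B]
    [Algebra.FiniteType k B] (U : Variety k) (i : U.obj ⟶ specOver k P) [IsClosedImmersion i.left]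
    (φ : P →ₐ[k] MvPolynomial PUnit.{u + 1} B) (hφ : Function.Surjective φ)
    (h : Set.range i.left = {x : PrimeSpectrum P | RingHom.ker φ ≤ x.asIdeal}) :
    cls U = lefschetz k * cls ⟨specOver k B, isVariety_specOver k B⟩ := by
  obtain ⟨e⟩ := nonempty_affineLine_tensor_iso (k := k) B
  have := isClosedImmersion_specOverMap φ hφ
  rw [lefschetz, ← cls_tensor]
  refine Eq.trans ?_ (cls_eq_of_iso (Y := MonoidalCategoryStruct.tensorObj (affineLine k)
    ⟨specOver k B, isVariety_specOver k B⟩) (X := ⟨specOver k (MvPolynomial PUnit.{u + 1} B),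
    isVariety_specOver k _⟩) e.symm)
  exact cls_eq_of_range_eq i (specOverMap φ) (h.trans (range_specOverMap φ hφ).symm)

variable (k) in
/-- The projection `k[x₀, …, xₙ] → (k[x₁, …, xₙ] / J)[x₀]`. -/
noncomputable def cylinderMap {n : ℕ} (J : Ideal (MvPolynomial (Fin n) k)) :
    MvPolynomial (Fin (n + 1)) k →ₐ[k] MvPolynomial PUnit.{u + 1} (MvPolynomial (Fin n) k ⧸ J) :=
  MvPolynomial.aeval (Fin.cases (.X ⟨⟩) fun i => .C (Ideal.Quotient.mk J (.X i)))

lemma cylinderMap_rename {n : ℕ} (J : Ideal (MvPolynomial (Fin n) k))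
    (p : MvPolynomial (Fin n) k) : cylinderMap k J (MvPolynomial.rename Fin.succ p) =
      .C (Ideal.Quotient.mk J p) := by
  rw [cylinderMap, MvPolynomial.aeval_rename]
  change _ = ((IsScalarTower.toAlgHom k (MvPolynomial (Fin n) k ⧸ J)
    (MvPolynomial PUnit.{u + 1} (MvPolynomial (Fin n) k ⧸ J))).comp (Ideal.Quotient.mkₐ k J)) p
  congr 1
  ext i
  simp [MvPolynomial.algebraMap_eq]

lemma cylinderMap_surjective {n : ℕ} (J : Ideal (MvPolynomial (Fin n) k)) :
    Function.Surjective (cylinderMap k J) := by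
  intro q
  induction q using MvPolynomial.induction_on with
  | C b =>
    obtain ⟨p, rfl⟩ := Ideal.Quotient.mk_surjective b
    exact ⟨_, cylinderMap_rename J p⟩
  | add p q hp hq =>
    obtain ⟨p', rfl⟩ := hp
    obtain ⟨q', rfl⟩ := hq
    exact ⟨p' + q', map_add _ _ _⟩
  | mul_X p i hp =>
    obtain ⟨p', rfl⟩ := hp
    exact ⟨p' * .X 0, by simp [cylinderMap]⟩

lemma ker_cylinderMap {n : ℕ} (S : Set (MvPolynomial (Fin n) k)) :
    RingHom.ker (cylinderMap k (Ideal.span S)) =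
      Ideal.span (MvPolynomial.rename Fin.succ '' S) := by
  set J := Ideal.span S
  set I : Ideal (MvPolynomial (Fin (n + 1)) k) :=
    Ideal.span (MvPolynomial.rename Fin.succ '' S)
  refine le_antisymm ?_ ?_
  · -- a one-sided inverse modulo `I`
    have hJ (a) (ha : a ∈ J) :
        ((Ideal.Quotient.mk I).comp (MvPolynomial.rename Fin.succ).toRingHom) a = 0 := by
      rw [← RingHom.mem_ker]
      refine (Ideal.span_le.mpr ?_ : J ≤ _) ha
      intro s hs
      rw [SetLike.mem_coe, RingHom.mem_ker]
      exact Ideal.Quotient.eq_zero_iff_mem.mpr (Ideal.subset_span ⟨s, hs, rfl⟩)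
    let ψ : MvPolynomial PUnit.{u + 1} (MvPolynomial (Fin n) k ⧸ J) →+*
        MvPolynomial (Fin (n + 1)) k ⧸ I :=
      MvPolynomial.eval₂Hom (Ideal.Quotient.lift J _ hJ) fun _ => Ideal.Quotient.mk I (.X 0)
    have hψ : ψ.comp (cylinderMap k J).toRingHom = Ideal.Quotient.mk I := by
      ext j
      · have h1 : (MvPolynomial.C j : MvPolynomial (Fin (n + 1)) k) =
          MvPolynomial.rename Fin.succ (.C j) := (MvPolynomial.rename_C _ _).symm
        have h2 : cylinderMap k J (.C j) = _ := h1 ▸ cylinderMap_rename J (.C j)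
        simp [ψ, h2]
      · refine Fin.cases ?_ (fun j => ?_) j
        · simp [ψ, cylinderMap]
        · simp only [ψ, cylinderMap, RingHom.comp_apply, AlgHom.toRingHom_eq_coe, RingHom.coe_coe,
            MvPolynomial.aeval_X, Fin.cases_succ, MvPolynomial.coe_eval₂Hom,
            MvPolynomial.eval₂_C, Ideal.Quotient.lift_mk, MvPolynomial.rename_X]
    intro p hp
    rw [← Ideal.Quotient.eq_zero_iff_mem, ← hψ]
    change ψ (cylinderMap k J p) = 0
    rw [RingHom.mem_ker.mp hp, map_zero]
  · refine Ideal.span_le.mpr ?_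
    rintro _ ⟨s, hs, rfl⟩
    rw [SetLike.mem_coe, RingHom.mem_ker, cylinderMap_rename, Ideal.Quotient.eq_zero_iff_mem.mpr
      (Ideal.subset_span hs), map_zero]

/-- If a closed subvariety of `𝔸ⁿ⁺¹` is set-theoretically cut out by equations that do not involve
the first coordinate, then its class is divisible by `𝕃`. -/
lemma lefschetz_dvd_cls_of_cylinder {n : ℕ} (U : Variety k)
    (i : U.obj ⟶ specOver k (MvPolynomial (Fin (n + 1)) k)) [IsClosedImmersion i.left]
    (S : Set (MvPolynomial (Fin n) k))
    (h : Set.range i.left = {x : PrimeSpectrum (MvPolynomial (Fin (n + 1)) k) |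
      ∀ s ∈ S, MvPolynomial.rename Fin.succ s ∈ x.asIdeal}) :
    lefschetz k ∣ cls U := by
  refine ⟨_, cls_eq_lefschetz_mul U i _ (cylinderMap_surjective (Ideal.span S)) ?_⟩
  rw [h, ker_cylinderMap]
  ext x
  change _ ↔ Ideal.span _ ≤ _
  rw [Ideal.span_le, Set.image_subset_iff]
  rfl

/-- A subvariety of an affine scheme whose underlying set is that of a `k`-rational point has
class `1` and has a rational point. -/
lemma cls_eq_one_of_point {R : Type u} [CommRing R] [Algebra k R] (U : Variety k)
    (i : U.obj ⟶ specOver k R) [IsClosedImmersion i.left] (φ : R →ₐ[k] k)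
    (h : Set.range i.left = {x : PrimeSpectrum R | RingHom.ker φ ≤ x.asIdeal}) :
    cls U = 1 ∧ Nonempty (RationalPoints U) := by
  let T : Over (Spec (.of k)) := Over.mk (𝟙 (Spec (.of k)))
  have hsurj : Function.Surjective φ := fun a => ⟨algebraMap k R a, φ.commutes a⟩
  let j : T ⟶ specOver k R := Over.homMk (Spec.map (CommRingCat.ofHom φ.toRingHom)) (by
    simp only [T, Over.mk_hom, ← Spec.map_comp, ← CommRingCat.ofHom_comp]
    rw [← Spec.map_id]
    congr 2
    exact φ.comp_algebraMap)
  have : IsClosedImmersion j.left := IsClosedImmersion.spec_of_surjective _ hsurj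
  have hj : Set.range i.left = Set.range j.left :=
    h.trans (range_comap_of_surjective _ φ.toRingHom hsurj).symm
  refine ⟨?_, ?_⟩
  · rw [← cls_unit]
    exact cls_eq_of_range_eq (Y := MonoidalCategoryStruct.tensorUnit (Variety k)) i j hj
  · have : Surjective (pullback.snd i.left j.left) := ⟨by
      rw [← Set.range_eq_univ, Scheme.Pullback.range_snd, hj, Set.preimage_range]⟩
    have : AlgebraicGeometry.IsReduced T.left :=
      inferInstanceAs (AlgebraicGeometry.IsReduced (Spec (.of k)))
    have : IsIso (pullback.snd i.left j.left) := isIso_of_isClosedImmersion_of_surjective _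
    refine ⟨Over.homMk (inv (pullback.snd i.left j.left) ≫ pullback.fst i.left j.left) ?_⟩
    rw [← Over.w i, Category.assoc, pullback.condition_assoc, IsIso.inv_hom_id_assoc]
    exact Over.w j

end Affine

/-! ### Charts of projective space -/

section Charts

open HomogeneousLocalization

variable {k : Type u} [Field k] {n : ℕ}

/-- A linear change of coordinates on `k[x₀, …, xₙ]`: an automorphism of the `k`-algebra that
preserves homogeneous polynomials of each degree. The new coordinates are the linear forms
`e.symm (X i)`. -/
structure CoordChange (k : Type u) [Field k] (n : ℕ) where
  /-- The automorphism that writes a polynomial in terms of the new coordinates. -/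
  e : MvPolynomial (Fin (n + 1)) k ≃ₐ[k] MvPolynomial (Fin (n + 1)) k
  isHomogeneous {p : MvPolynomial (Fin (n + 1)) k} {m : ℕ} : p.IsHomogeneous m →
    (e p).IsHomogeneous m
  isHomogeneous_symm {p : MvPolynomial (Fin (n + 1)) k} {m : ℕ} : p.IsHomogeneous m →
    (e.symm p).IsHomogeneous m

namespace CoordChange

variable (c : CoordChange k n) (i : Fin (n + 1))

/-- The `i`-th new coordinate. -/
noncomputable def y : MvPolynomial (Fin (n + 1)) k := c.e.symm (.X i)

lemma y_mem : c.y i ∈ grading k n 1 := c.isHomogeneous_symm (MvPolynomial.isHomogeneous_X k i)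

lemma e_C (a : k) : c.e (.C a) = .C a := c.e.commutes a

lemma e_symm_C (a : k) : c.e.symm (.C a) = .C a := c.e.symm.commutes a

lemma e_y : c.e (c.y i) = .X i := c.e.apply_symm_apply _

/-- The ring homomorphism `k[x₀, …, xₙ] → k[x₀, …, xₙ]_(yᵢ)`, `xⱼ ↦ yⱼ / yᵢ`, where `y₀, …, yₙ` are
the new coordinates. -/
noncomputable def chartMap : MvPolynomial (Fin (n + 1)) k →+* Away (grading k n) (c.y i) :=
  MvPolynomial.eval₂Hom ((fromZeroRingHom (grading k n) _).comp (algebraMap k (grading k n 0)))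
    fun j => Away.mk (grading k n) (c.y_mem i) 1 (c.y j) (by simpa using c.y_mem j)

lemma chartMap_comp_C : (c.chartMap i).comp MvPolynomial.C =
    (fromZeroRingHom (grading k n) _).comp (algebraMap k (grading k n 0)) := by
  ext a
  simp [chartMap]

/-- The chart map, followed by the inclusion into the full localization. -/
noncomputable def chartVal : MvPolynomial (Fin (n + 1)) k →+* Localization.Away (c.y i) :=
  (algebraMap (Away (grading k n) (c.y i)) (Localization.Away (c.y i))).comp (c.chartMap i)

lemma chartVal_C (a : k) : c.chartVal i (.C a) =
    algebraMap (MvPolynomial (Fin (n + 1)) k) _ (MvPolynomial.C a) := by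
  have h := RingHom.congr_fun (c.chartMap_comp_C i) a
  rw [RingHom.comp_apply] at h
  rw [chartVal, RingHom.comp_apply, h]
  rfl

lemma chartVal_X (j : Fin (n + 1)) : c.chartVal i (.X j) =
    Localization.mk (c.y j) (⟨c.y i ^ 1, 1, rfl⟩ : Submonoid.powers (c.y i)) := by
  rw [chartVal, RingHom.comp_apply, chartMap, MvPolynomial.coe_eval₂Hom, MvPolynomial.eval₂_X,
    HomogeneousLocalization.algebraMap_apply, Away.val_mk]

lemma mul_chartVal_X (j : Fin (n + 1)) :
    algebraMap _ (Localization.Away (c.y i)) (c.y i) * c.chartVal i (.X j) =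
      algebraMap _ (Localization.Away (c.y i)) (c.y j) := by
  rw [chartVal_X, ← Localization.mk_one_eq_algebraMap, Localization.mk_mul,
    ← Localization.mk_one_eq_algebraMap, Localization.mk_eq_mk_iff, Localization.r_iff_exists]
  exact ⟨1, by simp⟩

lemma _root_.MvPolynomial.IsHomogeneous.eval₂_mul {σ R S : Type*} [CommSemiring R] [CommSemiring S]
    {p : MvPolynomial σ R} {m : ℕ} (hp : p.IsHomogeneous m) (f : R →+* S) (r : S) (s : σ → S) :
    p.eval₂ f (fun j => r * s j) = r ^ m * p.eval₂ f s := by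
  rw [MvPolynomial.eval₂_eq, MvPolynomial.eval₂_eq, Finset.mul_sum]
  refine Finset.sum_congr rfl fun d hd => ?_
  have h : ∑ j ∈ d.support, d j = m := by
    rw [← hp (MvPolynomial.mem_support_iff.mp hd), Finsupp.weight_apply, Finsupp.sum]
    simp
  simp only [mul_pow]
  rw [Finset.prod_mul_distrib, Finset.prod_pow_eq_pow_sum, h]
  ring

lemma pow_mul_chartVal {m : ℕ} {p : MvPolynomial (Fin (n + 1)) k} (hp : p.IsHomogeneous m) :
    algebraMap _ (Localization.Away (c.y i)) (c.y i) ^ m * c.chartVal i p =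
      algebraMap _ (Localization.Away (c.y i)) (c.e.symm p) := by
  have h1 : c.chartVal i p = p.eval₂ ((algebraMap (MvPolynomial (Fin (n + 1)) k) _).comp MvPolynomial.C)
      fun j => c.chartVal i (.X j) := by
    change _ = MvPolynomial.eval₂Hom _ _ p
    congr 1
    refine MvPolynomial.ringHom_ext (fun j => ?_) fun j => ?_
    · rw [chartVal_C, MvPolynomial.coe_eval₂Hom, MvPolynomial.eval₂_C, RingHom.comp_apply]
    · rw [MvPolynomial.coe_eval₂Hom, MvPolynomial.eval₂_X]
  have h2 : algebraMap _ (Localization.Away (c.y i)) (c.e.symm p) =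
      p.eval₂ ((algebraMap (MvPolynomial (Fin (n + 1)) k) _).comp MvPolynomial.C)
        fun j => algebraMap _ (Localization.Away (c.y i)) (c.y j) := by
    change ((algebraMap (MvPolynomial (Fin (n + 1)) k) (Localization.Away (c.y i))).comp
      c.e.symm.toAlgHom.toRingHom) p = MvPolynomial.eval₂Hom _ _ p
    congr 1
    refine MvPolynomial.ringHom_ext (fun j => ?_) fun j => ?_
    · change algebraMap _ (Localization.Away (c.y i)) (c.e.symm (.C j)) =
        MvPolynomial.eval₂ _ _ (.C j)
      rw [e_symm_C, MvPolynomial.eval₂_C, RingHom.comp_apply]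
    · change algebraMap _ (Localization.Away (c.y i)) (c.e.symm (.X j)) =
        MvPolynomial.eval₂ _ _ (.X j)
      rw [MvPolynomial.eval₂_X]
      rfl
  rw [h1, h2, ← hp.eval₂_mul]
  simp only [mul_chartVal_X]

/-- The chart map dehomogenizes: `a ↦ a / yᵢ ^ m` for `a` homogeneous of degree `m`. -/
lemma chartMap_e {m : ℕ} {a : MvPolynomial (Fin (n + 1)) k} (ha : a.IsHomogeneous m) :
    c.chartMap i (c.e a) = Away.mk (grading k n) (c.y_mem i) m a (by simpa using ha) := by
  refine HomogeneousLocalization.val_injective _ ?_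
  have h := c.pow_mul_chartVal i (c.isHomogeneous ha)
  rw [AlgEquiv.symm_apply_apply] at h
  have hu : IsUnit (algebraMap _ (Localization.Away (c.y i)) (c.y i) ^ m) :=
    (IsLocalization.Away.algebraMap_isUnit _).pow m
  refine hu.mul_left_cancel (h.trans ?_)
  rw [Away.val_mk, ← map_pow, ← Localization.mk_one_eq_algebraMap,
    ← Localization.mk_one_eq_algebraMap, Localization.mk_mul, Localization.mk_eq_mk_iff, Localization.r_iff_exists]
  exact ⟨1, by simp⟩

lemma chartMap_surjective : Function.Surjective (c.chartMap i) := by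
  intro z
  obtain ⟨m, a, ha, rfl⟩ := Away.mk_surjective _ (c.y_mem i) z
  exact ⟨_, c.chartMap_e i (m := m) (by simpa using ha)⟩

lemma ker_chartMap : RingHom.ker (c.chartMap i) = Ideal.span {.X i - 1} := by
  set I : Ideal (MvPolynomial (Fin (n + 1)) k) := Ideal.span {.X i - 1}
  have hI : Ideal.Quotient.mk I (.X i) = 1 := by
    rw [← map_one (Ideal.Quotient.mk I), Ideal.Quotient.eq]
    exact Ideal.subset_span rfl
  refine le_antisymm ?_ ?_
  · -- setting `yᵢ = 1` inverts the chart map modulo `xᵢ - 1`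
    let g : MvPolynomial (Fin (n + 1)) k →+* MvPolynomial (Fin (n + 1)) k ⧸ I :=
      (Ideal.Quotient.mk I).comp c.e.toAlgHom.toRingHom
    have hg (j) : g (c.y j) = Ideal.Quotient.mk I (.X j) :=
      congrArg (Ideal.Quotient.mk I) (c.e_y j)
    have hu : IsUnit (g (c.y i)) := by rw [hg, hI]; exact isUnit_one
    let χ : Localization.Away (c.y i) →+* MvPolynomial (Fin (n + 1)) k ⧸ I :=
      IsLocalization.Away.lift (c.y i) hu
    have hχ (a) : χ (algebraMap _ _ a) = g a := IsLocalization.Away.lift_eq _ hu a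
    have h : χ.comp (c.chartVal i) = Ideal.Quotient.mk I := by
      ext j
      · simp only [RingHom.comp_apply, chartVal_C, hχ]
        exact congrArg (Ideal.Quotient.mk I) (c.e_C j)
      · have := congrArg χ (c.mul_chartVal_X i j)
        rw [map_mul, hχ, hχ, hg, hg, hI, one_mul] at this
        exact this
    intro p hp
    rw [← Ideal.Quotient.eq_zero_iff_mem, ← h]
    change χ (algebraMap _ _ (c.chartMap i p)) = 0
    rw [RingHom.mem_ker.mp hp, map_zero, map_zero]
  · refine Ideal.span_le.mpr ?_
    rintro _ rfl
    rw [SetLike.mem_coe, RingHom.mem_ker, map_sub, map_one, sub_eq_zero, ← c.e_y,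
      c.chartMap_e i (c.y_mem i)]
    refine HomogeneousLocalization.val_injective _ ?_
    rw [Away.val_mk, HomogeneousLocalization.val_one, ← Localization.mk_one,
      Localization.mk_eq_mk_iff, Localization.r_iff_exists]
    exact ⟨1, by simp⟩

/-- The closed immersion of the chart `D₊(yᵢ)` into `𝔸ⁿ⁺¹`, with image the hyperplane `xᵢ = 1`. -/
noncomputable def chartHom : Spec (.of (Away (grading k n) (c.y i))) ⟶
    Spec (.of (MvPolynomial (Fin (n + 1)) k)) :=
  Spec.map (CommRingCat.ofHom (c.chartMap i))

instance : IsClosedImmersion (c.chartHom i) :=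
  IsClosedImmersion.spec_of_surjective _ (c.chartMap_surjective i)

lemma range_chartHom : Set.range (c.chartHom i) =
    {x : PrimeSpectrum (MvPolynomial (Fin (n + 1)) k) | .X i - 1 ∈ x.asIdeal} := by
  refine (range_comap_of_surjective _ _ (c.chartMap_surjective i)).trans ?_
  ext x
  change RingHom.ker (c.chartMap i) ≤ _ ↔ _
  rw [ker_chartMap, Ideal.span_le, Set.singleton_subset_iff]
  rfl

/-- The inclusion of the chart `D₊(yᵢ)`. -/
noncomputable def chartι : Spec (.of (Away (grading k n) (c.y i))) ⟶ Proj (grading k n) :=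
  Proj.awayι (grading k n) (c.y i) (c.y_mem i) one_pos

instance : IsOpenImmersion (c.chartι i) :=
  inferInstanceAs (IsOpenImmersion (Proj.awayι ..))

lemma range_chartι : Set.range (c.chartι i) = {x | c.y i ∉ x.asHomogeneousIdeal} :=
  congrArg (SetLike.coe) (Proj.opensRange_awayι (grading k n) (c.y i) (c.y_mem i) one_pos)

lemma chartι_projToSpec : c.chartι i ≫ projToSpec k n =
    c.chartHom i ≫ Spec.map (CommRingCat.ofHom (algebraMap k (MvPolynomial (Fin (n + 1)) k))) := by
  rw [projToSpec, chartι, Proj.awayι_toSpecZero_assoc, chartHom, ← Spec.map_comp,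
    ← Spec.map_comp, ← CommRingCat.ofHom_comp, ← CommRingCat.ofHom_comp,
    MvPolynomial.algebraMap_eq, chartMap_comp_C]

lemma mem_chartι_iff {m : ℕ} {g : MvPolynomial (Fin (n + 1)) k} (hg : g.IsHomogeneous m)
    (hm : 0 < m) (x : Spec (.of (Away (grading k n) (c.y i)))) :
    g ∈ (c.chartι i x).asHomogeneousIdeal ↔
      c.e g ∈ (show PrimeSpectrum (MvPolynomial (Fin (n + 1)) k) from c.chartHom i x).asIdeal := by
  have h := Proj.awayι_preimage_basicOpen (grading k n) (c.y_mem i) one_pos hg hm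
  have h' : x ∈ c.chartι i ⁻¹ᵁ Proj.basicOpen (grading k n) g ↔
      x ∈ PrimeSpectrum.basicOpen (Away.isLocalizationElem (c.y_mem i) hg) := by
    rw [← h]; rfl
  refine not_iff_not.mp (Iff.trans ?_ (h'.trans ?_))
  · rfl
  · change Away.isLocalizationElem (c.y_mem i) hg ∉ x.asIdeal ↔
      c.chartMap i (c.e g) ∉ x.asIdeal
    rw [c.chartMap_e i hg]
    simp only [Away.isLocalizationElem, pow_one]

/-- The chart `D₊(yᵢ)` of a closed subvariety of `ℙⁿ`, as a closed subvariety of `𝔸ⁿ⁺¹`. -/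
lemma exists_chart (Y : Variety k) (ι : Y.obj ⟶ projSpace k n) [IsClosedImmersion ι.left]
    (G : Set (MvPolynomial (Fin (n + 1)) k)) (hG : ∀ g ∈ G, ∃ m, 0 < m ∧ g.IsHomogeneous m)
    (hY : Set.range ι.left = {x : Proj (grading k n) | ∀ g ∈ G, g ∈ x.asHomogeneousIdeal}) :
    ∃ (U : Variety k) (j : U.obj ⟶ Y.obj) (a : U.obj ⟶ specOver k (MvPolynomial (Fin (n + 1)) k)),
      IsOpenImmersion j.left ∧ IsClosedImmersion a.left ∧
      Set.range j.left = {x | c.y i ∉ (show Proj (grading k n) from ι.left x).asHomogeneousIdeal} ∧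
      Set.range a.left = {x : PrimeSpectrum (MvPolynomial (Fin (n + 1)) k) |
        .X i - 1 ∈ x.asIdeal ∧ ∀ g ∈ G, c.e g ∈ x.asIdeal} := by
  let U : Over (Spec (.of k)) := Over.mk (pullback.fst ι.left (c.chartι i) ≫ Y.obj.hom)
  let j : U ⟶ Y.obj := Over.homMk (pullback.fst ι.left (c.chartι i))
  have hj : IsOpenImmersion j.left := inferInstanceAs (IsOpenImmersion (pullback.fst _ _))
  let a : U ⟶ specOver k (MvPolynomial (Fin (n + 1)) k) :=
    Over.homMk (pullback.snd ι.left (c.chartι i) ≫ c.chartHom i) (by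
      refine (Category.assoc _ _ _).trans ?_
      refine (congrArg (pullback.snd _ _ ≫ ·) (c.chartι_projToSpec i).symm).trans ?_
      refine (pullback.condition_assoc _).symm.trans ?_
      exact congrArg (pullback.fst _ _ ≫ ·) (Over.w ι))
  have ha : IsClosedImmersion a.left :=
    inferInstanceAs (IsClosedImmersion (pullback.snd ι.left (c.chartι i) ≫ c.chartHom i))
  refine ⟨⟨U, isVariety_of_immersion Y j⟩, j, a, hj, ha, ?_, ?_⟩
  · change Set.range (pullback.fst ι.left (c.chartι i)) = _
    rw [Scheme.Pullback.range_fst, range_chartι]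
    rfl
  · change Set.range (pullback.snd ι.left (c.chartι i) ≫ c.chartHom i) = _
    have hmem (w) : w ∈ Set.range (pullback.snd ι.left (c.chartι i)) ↔ ∀ g ∈ G, c.e g ∈
        (show PrimeSpectrum (MvPolynomial (Fin (n + 1)) k) from c.chartHom i w).asIdeal := by
      rw [Scheme.Pullback.range_snd, hY]
      refine forall₂_congr fun g hg => ?_
      obtain ⟨m, hm, hgm⟩ := hG g hg
      exact c.mem_chartι_iff i hgm hm w
    ext x
    refine ⟨?_, fun ⟨hx, hx'⟩ => ?_⟩
    · rintro ⟨u, rfl⟩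
      have h : c.chartHom i (pullback.snd ι.left (c.chartι i) u) ∈ Set.range (c.chartHom i) :=
        ⟨_, rfl⟩
      rw [range_chartHom] at h
      exact ⟨h, (hmem _).mp ⟨u, rfl⟩⟩
    · obtain ⟨w, rfl⟩ : x ∈ Set.range (c.chartHom i) := by rw [range_chartHom]; exact hx
      obtain ⟨u, rfl⟩ := (hmem w).mpr hx'
      exact ⟨u, rfl⟩

end CoordChange

end Charts

/-! ### Stratification of a cone -/

section Cone

variable {k : Type u} [Field k] {n : ℕ}

lemma _root_.MvPolynomial.IsHomogeneous.mem_span_X {σ R : Type*} [CommRing R]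
    {p : MvPolynomial σ R} {m : ℕ} (hp : p.IsHomogeneous m) (hm : 0 < m) :
    p ∈ Ideal.span (Set.range (MvPolynomial.X : σ → MvPolynomial σ R)) := by
  rw [← Set.image_univ, MvPolynomial.mem_ideal_span_X_image]
  intro d hd
  by_contra! hc
  have h0 : d = 0 := Finsupp.ext fun i => hc i (Set.mem_univ i)
  have := hp (MvPolynomial.mem_support_iff.mp hd)
  rw [h0, map_zero] at this
  exact hm.ne this

namespace CoordChange

variable (c : CoordChange k n)

/-- The coordinates have no common zero on `ℙⁿ`. -/
lemma exists_y_notMem (x : Proj (grading k n)) : ∃ i, c.y i ∉ x.asHomogeneousIdeal := by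
  by_contra! h
  refine x.not_irrelevant_le ?_
  refine (HomogeneousIdeal.toIdeal_irrelevant_le _).mpr fun m hm p hp => ?_
  have h1 : Ideal.span (Set.range MvPolynomial.X) ≤
      x.asHomogeneousIdeal.toIdeal.comap c.e.symm := by
    rw [Ideal.span_le]
    rintro _ ⟨i, rfl⟩
    exact h i
  have h2 := h1 ((c.isHomogeneous hp).mem_span_X hm)
  rw [Ideal.mem_comap, AlgEquiv.symm_apply_apply] at h2
  exact h2

/-- The equations of the intersection of `V(f)` with the linear subspace on which the coordinates
`y₁, …, yₘ` vanish. -/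
def stratumEqns (f : MvPolynomial (Fin (n + 1)) k) (m : ℕ) : Set (MvPolynomial (Fin (n + 1)) k) :=
  {f} ∪ {g | ∃ j : Fin n, j.val < m ∧ g = c.y j.succ}

lemma isHomogeneous_of_mem_stratumEqns {f : MvPolynomial (Fin (n + 1)) k} {d : ℕ} (hd : 0 < d)
    (hf : f.IsHomogeneous d) {m : ℕ} : ∀ g ∈ c.stratumEqns f m, ∃ e, 0 < e ∧ g.IsHomogeneous e := by
  rintro g (rfl | ⟨j, -, rfl⟩)
  · exact ⟨d, hd, hf⟩
  · exact ⟨1, one_pos, c.y_mem _⟩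

/-- A subvariety of `ℙⁿ` supported at the vertex `y₁ = … = yₙ = 0` of the cone lies in the chart
`D₊(y₀)`, where it has the underlying set of a rational point. -/
lemma cls_eq_one_of_vertex {f : MvPolynomial (Fin (n + 1)) k} {d : ℕ} (hd : 0 < d)
    (hf : f.IsHomogeneous d) {F : MvPolynomial (Fin n) k}
    (hF : c.e f = MvPolynomial.rename Fin.succ F) (Y : Variety k) (ι : Y.obj ⟶ projSpace k n)
    [IsClosedImmersion ι.left] (hY : Set.range ι.left =
      {x : Proj (grading k n) | ∀ g ∈ c.stratumEqns f n, g ∈ x.asHomogeneousIdeal}) :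
    cls Y = 1 ∧ Nonempty (RationalPoints Y) := by
  obtain ⟨U, j, a, hj, ha, hj', ha'⟩ := c.exists_chart 0 Y ι _
    (c.isHomogeneous_of_mem_stratumEqns hd hf) hY
  have : Surjective j.left := ⟨by
    rw [← Set.range_eq_univ, hj', Set.eq_univ_iff_forall]
    intro x
    obtain ⟨i, hi⟩ := c.exists_y_notMem (ι.left x)
    refine Fin.cases (fun h => h) (fun i' h => (h ?_).elim) i hi
    have hx : ι.left x ∈ Set.range ι.left := ⟨x, rfl⟩
    rw [hY] at hx
    exact hx _ (Or.inr ⟨i', i'.2, rfl⟩)⟩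
  have : IsIso j.left := (isIso_iff_isOpenImmersion_and_surjective _).mpr ⟨hj, this⟩
  have : IsIso j := 
    have : IsIso ((Over.forget _).map j) := ‹IsIso j.left›
    isIso_of_reflects_iso j (Over.forget _)
  let φ : MvPolynomial (Fin (n + 1)) k →ₐ[k] k := MvPolynomial.aeval (Fin.cases 1 0)
  obtain ⟨h1, ⟨p⟩⟩ := cls_eq_one_of_point U a φ (by
    rw [ha']
    ext x
    refine ⟨fun ⟨h0, h⟩ p hp => ?_, fun h => ⟨h ?_, ?_⟩⟩
    · have key : (Ideal.Quotient.mk x.asIdeal).comp ((algebraMap k _).comp φ.toRingHom) =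
          Ideal.Quotient.mk x.asIdeal := by
        refine MvPolynomial.ringHom_ext (fun b => ?_) fun i => ?_
        · exact congrArg (fun t => Ideal.Quotient.mk x.asIdeal (MvPolynomial.C t)) (φ.commutes b)
        · refine Fin.cases ?_ (fun i => ?_) i
          · simp only [RingHom.comp_apply, φ, AlgHom.toRingHom_eq_coe, RingHom.coe_coe,
              MvPolynomial.aeval_X, Fin.cases_zero, map_one]
            rw [eq_comm, ← map_one (Ideal.Quotient.mk x.asIdeal), Ideal.Quotient.eq]
            exact h0
          · simp only [RingHom.comp_apply, φ, AlgHom.toRingHom_eq_coe, RingHom.coe_coe,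
              MvPolynomial.aeval_X, Fin.cases_succ, map_zero, Pi.zero_apply]
            rw [eq_comm, Ideal.Quotient.eq_zero_iff_mem, ← c.e_y]
            exact h _ (Or.inr ⟨i, i.2, rfl⟩)
      rw [← Ideal.Quotient.eq_zero_iff_mem, ← key]
      simp only [RingHom.comp_apply]
      rw [show φ.toRingHom p = 0 from hp, map_zero, map_zero]
    · simp [φ, RingHom.mem_ker]
    · rintro g (rfl | ⟨i, -, rfl⟩)
      · refine h ?_
        rw [RingHom.mem_ker, hF, MvPolynomial.aeval_rename]
        have e0 : MvPolynomial.constantCoeff (c.e g) = 0 := by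
          rw [MvPolynomial.constantCoeff_eq]
          exact (c.isHomogeneous hf).coeff_eq_zero (by simpa using hd.ne)
        rw [hF, MvPolynomial.constantCoeff_rename] at e0
        change MvPolynomial.aeval (fun _ => (0 : k)) F = 0
        rw [MvPolynomial.aeval_zero', e0, map_zero]
      · refine h ?_
        rw [RingHom.mem_ker, c.e_y]
        simp [φ])
  exact ⟨(cls_eq_of_iso (asIso j)).symm.trans h1, ⟨p ≫ j⟩⟩

/-- The class of a cone, cut by the linear subspace `y₁ = … = yₘ = 0`, modulo `𝕃`: in the chart
`yₘ₊₁ ≠ 0` none of the equations involves `y₀`, so what is cut away when passing from `m` to `m + 1`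
is a product with `𝔸¹`. -/
lemma lefschetz_dvd_cls_sub_one {f : MvPolynomial (Fin (n + 1)) k} {d : ℕ} (hd : 0 < d)
    (hf : f.IsHomogeneous d) {F : MvPolynomial (Fin n) k}
    (hF : c.e f = MvPolynomial.rename Fin.succ F) {m : ℕ} (hm : m ≤ n) (Y : Variety k)
    (ι : Y.obj ⟶ projSpace k n) [IsClosedImmersion ι.left] (hY : Set.range ι.left =
      {x : Proj (grading k n) | ∀ g ∈ c.stratumEqns f m, g ∈ x.asHomogeneousIdeal}) :
    lefschetz k ∣ cls Y - 1 ∧ Nonempty (RationalPoints Y) := by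
  induction hm using Nat.decreasingInduction generalizing Y with
  | self =>
    obtain ⟨h1, h2⟩ := c.cls_eq_one_of_vertex hd hf hF Y ι hY
    exact ⟨by rw [h1, sub_self]; exact dvd_zero _, h2⟩
  | of_succ m hm ih =>
    let j₀ : Fin n := ⟨m, hm⟩
    obtain ⟨U, j, a, hj, ha, hj', ha'⟩ := c.exists_chart j₀.succ Y ι _
      (c.isHomogeneous_of_mem_stratumEqns hd hf) hY
    have hs : IsClosed (Set.range j.left)ᶜ := hj.base_open.isOpen_range.isClosed_compl
    obtain ⟨Z, i, hi, hi'⟩ := exists_closed_subvariety Y hs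
    have hZ : IsClosedImmersion (i ≫ ι).left :=
      inferInstanceAs (IsClosedImmersion (i.left ≫ ι.left))
    obtain ⟨h1, ⟨p⟩⟩ := ih Z (i ≫ ι) (by
      have hr : Set.range (i ≫ ι).left = ι.left '' Set.range i.left := by
        rw [← Set.range_comp]; rfl
      rw [hr, hi', hj']
      ext x
      constructor
      · rintro ⟨y, hy, rfl⟩ g hg
        have hy' : ι.left y ∈ Set.range ι.left := ⟨y, rfl⟩
        rw [hY] at hy'
        rcases hg with hg | ⟨l, hl, rfl⟩
        · exact hy' g (Or.inl hg)
        · rcases (Nat.lt_succ_iff.mp hl).lt_or_eq with h | h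
          · exact hy' _ (Or.inr ⟨l, h, rfl⟩)
          · obtain rfl : l = j₀ := Fin.ext h
            exact not_not.mp hy
      · intro hx
        obtain ⟨y, rfl⟩ : x ∈ Set.range ι.left := by
          rw [hY]
          rintro g (hg | ⟨l, hl, rfl⟩)
          · exact hx g (Or.inl hg)
          · exact hx _ (Or.inr ⟨l, hl.trans (Nat.lt_succ_self m), rfl⟩)
        exact ⟨y, not_not.mpr (hx _ (Or.inr ⟨j₀, Nat.lt_succ_self m, rfl⟩)), rfl⟩)
    have h2 : lefschetz k ∣ cls U := by
      refine lefschetz_dvd_cls_of_cylinder U a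
        ({.X j₀ - 1} ∪ {F} ∪ {g | ∃ l : Fin n, l.val < m ∧ g = .X l}) ?_
      rw [ha']
      ext x
      refine ⟨?_, fun h => ⟨?_, ?_⟩⟩
      · rintro ⟨h0, h⟩ s ((rfl | rfl) | ⟨l, hl, rfl⟩)
        · simpa using h0
        · rw [← hF]
          exact h f (Or.inl rfl)
        · rw [MvPolynomial.rename_X, ← c.e_y]
          exact h _ (Or.inr ⟨l, hl, rfl⟩)
      · simpa using h _ (Or.inl (Or.inl rfl))
      · rintro g (rfl | ⟨l, hl, rfl⟩)
        · rw [hF]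
          exact h F (Or.inl (Or.inr rfl))
        · rw [c.e_y, ← MvPolynomial.rename_X]
          exact h _ (Or.inr ⟨l, hl, rfl⟩)
    refine ⟨?_, ⟨p ≫ i⟩⟩
    rw [cls_eq_add i j (by rw [hi', compl_compl]), add_sub_assoc]
    exact dvd_add h2 h1

end CoordChange

end Cone

/-! ### Translation invariant polynomials -/

section Translation

variable {σ R S : Type*} [CommRing R] [CommRing S]

/-- The translation `p(x) ↦ p(x + t v)` along the vector `v`, with values in polynomials in `t`. -/
noncomputable def translate (v : σ → R) :
    MvPolynomial σ R →+* Polynomial (MvPolynomial σ R) :=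
  MvPolynomial.eval₂Hom (Polynomial.C.comp MvPolynomial.C)
    fun i => Polynomial.C (.X i) + Polynomial.C (.C (v i)) * Polynomial.X

@[simp] lemma translate_C (v : σ → R) (a : R) :
    translate v (.C a) = Polynomial.C (.C a) := by
  simp [translate]

@[simp] lemma translate_X (v : σ → R) (i : σ) : translate v (.X i) =
    Polynomial.C (.X i) + Polynomial.C (.C (v i)) * Polynomial.X := by
  simp [translate]

lemma translate_zero (p : MvPolynomial σ R) : translate 0 p = Polynomial.C p := by
  refine RingHom.congr_fun (f := translate 0) (MvPolynomial.ringHom_ext ?_ ?_) p <;> simp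

lemma translate_add {v w : σ → R} {p : MvPolynomial σ R} (hv : translate v p = Polynomial.C p)
    (hw : translate w p = Polynomial.C p) : translate (v + w) p = Polynomial.C p := by
  have h : translate (v + w) = (Polynomial.eval₂RingHom (translate v) Polynomial.X).comp
      (translate w) := by
    refine MvPolynomial.ringHom_ext ?_ ?_
    · simp
    · intro i
      simp
      ring
  rw [h, RingHom.comp_apply, hw, Polynomial.coe_eval₂RingHom, Polynomial.eval₂_C, hv]

lemma translate_sum {ι : Type*} (s : Finset ι) {v : ι → σ → R} {p : MvPolynomial σ R}
    (h : ∀ i ∈ s, translate (v i) p = Polynomial.C p) :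
    translate (∑ i ∈ s, v i) p = Polynomial.C p :=
  Finset.sum_induction v (fun w => translate w p = Polynomial.C p) (fun _ _ => translate_add)
    (translate_zero p) h

lemma translate_map (φ : R →+* S) (v : σ → R) (p : MvPolynomial σ R) :
    translate (φ ∘ v) (MvPolynomial.map φ p) =
      (translate v p).map (MvPolynomial.map φ) := by
  change ((translate (φ ∘ v)).comp (MvPolynomial.map φ)) p =
    ((Polynomial.mapRingHom (MvPolynomial.map φ)).comp (translate v)) p
  congr 1
  refine MvPolynomial.ringHom_ext ?_ ?_ <;> simp

lemma translate_eq_C_of_map {φ : R →+* S} (hφ : Function.Injective φ) {v : σ → R}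
    {p : MvPolynomial σ R}
    (h : translate (φ ∘ v) (MvPolynomial.map φ p) = Polynomial.C (MvPolynomial.map φ p)) :
    translate v p = Polynomial.C p := by
  refine Polynomial.map_injective _ (MvPolynomial.map_injective φ hφ) ?_
  rw [← translate_map, h, Polynomial.map_C]

/-- A linear form is invariant under translation along the vectors on which it vanishes. -/
lemma translate_eq_C_of_isHomogeneous_one {v : σ → R} {p : MvPolynomial σ R}
    (hp : p.IsHomogeneous 1) (h : MvPolynomial.eval v p = 0) :
    translate v p = Polynomial.C p := by
  have key : translate v p = Polynomial.C p +
      Polynomial.C (.C (MvPolynomial.eval v p)) * Polynomial.X := by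
    have hp' : p ∈ MvPolynomial.homogeneousSubmodule σ R 1 := hp
    rw [MvPolynomial.homogeneousSubmodule_one_eq_span_X] at hp'
    clear hp h
    induction hp' using Submodule.span_induction with
    | mem p hp =>
      obtain ⟨i, rfl⟩ := hp
      simp
    | zero => simp
    | add p q _ _ hp hq =>
      rw [map_add, hp, hq]
      simp only [map_add]
      ring
    | smul a p _ hp =>
      rw [MvPolynomial.smul_eq_C_mul, map_mul, hp, translate_C]
      simp only [map_mul, MvPolynomial.eval_C]
      ring
  rw [key, h, map_zero, map_zero, zero_mul, add_zero]

/-- A divisor of a nonzero translation invariant polynomial is translation invariant. -/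
lemma translate_eq_C_of_dvd [IsDomain R] {v : σ → R} {p q : MvPolynomial σ R} (hq : q ≠ 0)
    (h : translate v q = Polynomial.C q) (hpq : p ∣ q) : translate v p = Polynomial.C p := by
  obtain ⟨r, rfl⟩ := hpq
  rw [map_mul] at h
  have hne : translate v p * translate v r ≠ 0 := by
    rw [h, Ne, Polynomial.C_eq_zero]; exact hq
  have hdeg : (translate v p).natDegree = 0 := by
    have := congrArg Polynomial.natDegree h
    rw [Polynomial.natDegree_C, Polynomial.natDegree_mul (left_ne_zero_of_mul hne)
      (right_ne_zero_of_mul hne)] at this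
    omega
  rw [Polynomial.eq_C_of_natDegree_eq_zero hdeg, Polynomial.coeff_zero_eq_eval_zero]
  congr 1
  change ((Polynomial.evalRingHom 0).comp (translate v)) p = RingHom.id _ p
  congr 1
  refine MvPolynomial.ringHom_ext ?_ ?_ <;> simp

end Translation

section ConeCoordinates

variable {k : Type u} [Field k] {n : ℕ}

/-- A polynomial that is invariant under translation along `w ≠ 0` does not involve the first
coordinate, for suitable linear coordinates. -/
lemma exists_coordChange {w : Fin (n + 1) → k} {i₀ : Fin (n + 1)} (hw : w i₀ = 1)
    {f : MvPolynomial (Fin (n + 1)) k} (hf : translate w f = Polynomial.C f) :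
    ∃ (c : CoordChange k n) (F : MvPolynomial (Fin n) k),
      c.e f = MvPolynomial.rename Fin.succ F := by
  let s : Fin (n + 1) ≃ Fin (n + 1) := Equiv.swap 0 i₀
  have hs0 : s 0 = i₀ := Equiv.swap_apply_left _ _
  have hs (l) : s (s l) = l := Equiv.swap_apply_self _ _ _
  let u (l : Fin (n + 1)) : MvPolynomial (Fin n) k := Fin.cases 0 .X l
  let aa (j : Fin (n + 1)) : MvPolynomial (Fin (n + 1)) k :=
    .C (w j) * .X 0 + .rename Fin.succ (u (s j))
  let a : MvPolynomial (Fin (n + 1)) k →ₐ[k] MvPolynomial (Fin (n + 1)) k :=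
    MvPolynomial.aeval aa
  let bb (l : Fin (n + 1)) : MvPolynomial (Fin (n + 1)) k :=
    Fin.cases (.X i₀) (fun l => .X (s l.succ) - .C (w (s l.succ)) * .X i₀) l
  let b : MvPolynomial (Fin (n + 1)) k →ₐ[k] MvPolynomial (Fin (n + 1)) k :=
    MvPolynomial.aeval bb
  have ha (j) : a (.X j) = .C (w j) * .X 0 + .rename Fin.succ (u (s j)) :=
    MvPolynomial.aeval_X _ _
  have hb0 : b (.X 0) = .X i₀ := MvPolynomial.aeval_X _ _
  have hb (l : Fin n) : b (.X l.succ) = .X (s l.succ) - .C (w (s l.succ)) * .X i₀ :=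
    MvPolynomial.aeval_X _ _
  have hbC (t) : b (.C t) = .C t := b.commutes t
  have haC (t) : a (.C t) = .C t := a.commutes t
  have hai : a (.X i₀) = .X 0 := by
    rw [ha, hw, ← hs0, hs]
    simp [u]
  have hu (l) : (u l).IsHomogeneous 1 := by
    refine Fin.cases ?_ (fun l => ?_) l
    · exact MvPolynomial.isHomogeneous_zero _ _ _
    · exact MvPolynomial.isHomogeneous_X _ _
  have haa (j) : (aa j).IsHomogeneous 1 :=
    (MvPolynomial.isHomogeneous_C_mul_X _ _).add ((hu _).rename_isHomogeneous)
  have hbb (l) : (bb l).IsHomogeneous 1 := by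
    refine Fin.cases ?_ (fun l => ?_) l
    · exact MvPolynomial.isHomogeneous_X _ _
    · exact (MvPolynomial.isHomogeneous_X _ _).sub (MvPolynomial.isHomogeneous_C_mul_X _ _)
  have hab : a.comp b = AlgHom.id k _ := by
    refine MvPolynomial.algHom_ext fun l => ?_
    refine Fin.cases ?_ (fun l => ?_) l
    · rw [AlgHom.comp_apply, hb0, hai, AlgHom.id_apply]
    · rw [AlgHom.comp_apply, hb, map_sub, map_mul, haC, hai, ha, hs]
      simp [u]
  have hba : b.comp a = AlgHom.id k _ := by
    refine MvPolynomial.algHom_ext fun j => ?_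
    obtain ⟨l, rfl⟩ := s.surjective j
    rw [AlgHom.comp_apply, ha, hs, map_add, map_mul, hbC, hb0]
    refine Fin.cases ?_ (fun l => ?_) l
    · simp [u, hs0, hw]
    · simp [u, hb]
  refine ⟨⟨AlgEquiv.ofAlgHom a b hab hba, ?_, ?_⟩, MvPolynomial.aeval (fun j => u (s j)) f, ?_⟩
  · intro p m hp
    have := hp.aeval aa haa
    rwa [one_mul] at this
  · intro p m hp
    have := hp.aeval bb hbb
    rwa [one_mul] at this
  · -- `a` is the translation along `t * w` at `t = x₀`, followed by a projection along `w`
    let r : MvPolynomial (Fin (n + 1)) k →+* MvPolynomial (Fin (n + 1)) k :=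
      ((MvPolynomial.rename Fin.succ).comp (MvPolynomial.aeval fun j => u (s j))).toRingHom
    have h : a.toRingHom = (Polynomial.eval₂RingHom r (.X 0)).comp (translate w) := by
      refine MvPolynomial.ringHom_ext (fun t => ?_) fun j => ?_
      · simp [r, haC, ← MvPolynomial.algebraMap_eq]
      · have e1 : a.toRingHom (.X j) = _ := ha j
        rw [e1]
        have e2 : r (.X j) = MvPolynomial.rename Fin.succ (u (s j)) :=
          congrArg (MvPolynomial.rename Fin.succ) (MvPolynomial.aeval_X (fun j => u (s j)) j)
        have e3 (t) : r (.C t) = .C t :=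
          ((MvPolynomial.rename Fin.succ).comp
            (MvPolynomial.aeval (R := k) fun j => u (s j))).commutes t
        simp only [RingHom.comp_apply, translate_X, Polynomial.coe_eval₂RingHom,
          Polynomial.eval₂_add, Polynomial.eval₂_mul, Polynomial.eval₂_C, Polynomial.eval₂_X,
          e2, e3, add_comm]
    change a.toRingHom f = _
    rw [h, RingHom.comp_apply, hf, Polynomial.coe_eval₂RingHom, Polynomial.eval₂_C]
    rfl

end ConeCoordinates

/-! ### Unions of hyperplanes over a Galois extension -/

section Hyperplanes

/-- `d ≤ n` linear forms in `n + 1` variables have a common nontrivial zero. -/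
lemma exists_common_zero {K : Type*} [Field K] {n d : ℕ} (hdn : d ≤ n)
    (h : Fin d → MvPolynomial (Fin (n + 1)) K) (hh : ∀ j, (h j).IsHomogeneous 1) :
    ∃ v : Fin (n + 1) → K, v ≠ 0 ∧ ∀ (a : K) (j : Fin d), MvPolynomial.eval (a • v) (h j) = 0 := by
  have hlin (v) (j) : MvPolynomial.eval v (h j) = ∑ i, v i * (h j).coeff (Finsupp.single i 1) := by
    have hj : h j ∈ MvPolynomial.homogeneousSubmodule (Fin (n + 1)) K 1 := hh j
    rw [MvPolynomial.homogeneousSubmodule_one_eq_span_X] at hj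
    generalize h j = p at hj
    induction hj using Submodule.span_induction with
    | mem p hp =>
      obtain ⟨i, rfl⟩ := hp
      simp [MvPolynomial.coeff_X, Finsupp.single_left_inj]
    | zero => simp
    | add p q _ _ hp hq => simp [hp, hq, mul_add, Finset.sum_add_distrib]
    | smul a p _ hp =>
      simp only [MvPolynomial.smul_eval, hp, MvPolynomial.coeff_smul, smul_eq_mul, Finset.mul_sum]
      exact Finset.sum_congr rfl fun _ _ => by ring
  let T : (Fin (n + 1) → K) →ₗ[K] (Fin d → K) :=
    Matrix.vecMulLinear (Matrix.of fun i j => (h j).coeff (Finsupp.single i 1))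
  have hT : T.ker ≠ ⊥ := LinearMap.ker_ne_bot_of_finrank_lt (by simp; omega)
  obtain ⟨v, hv, hv0⟩ := Submodule.exists_mem_ne_zero_of_ne_bot hT
  refine ⟨v, hv0, fun a j => ?_⟩
  have h1 : T (a • v) = 0 := by rw [map_smul, LinearMap.mem_ker.mp hv, smul_zero]
  rw [hlin]
  exact congrFun h1 j

/-- If over a Galois extension `L` of `k` the polynomial `f` divides a power of a product of few
linear forms, then `f` is invariant under translation along a nonzero vector over `k`. -/
lemma exists_translate_eq_C {k L : Type*} [Field k] [Field L] [Algebra k L]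
    [FiniteDimensional k L] [IsGalois k L] {n d : ℕ} (hdn : d ≤ n)
    (f : MvPolynomial (Fin (n + 1)) k)
    (h : Fin d → MvPolynomial (Fin (n + 1)) L) (hh : ∀ j, (h j).IsHomogeneous 1)
    (h0 : ∏ j, h j ≠ 0) (N : ℕ)
    (hdvd : MvPolynomial.map (algebraMap k L) f ∣ (∏ j, h j) ^ N) :
    ∃ (w : Fin (n + 1) → k) (i : Fin (n + 1)), w i = 1 ∧ translate w f = Polynomial.C f := by
  obtain ⟨v, hv, hvh⟩ := exists_common_zero hdn h hh
  obtain ⟨i, hi⟩ := Function.ne_iff.mp hv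
  obtain ⟨t, ht⟩ := Algebra.trace_surjective k L 1
  -- scale the common zero such that its `i`-th coordinate has trace `1`
  let a : L := t * (v i)⁻¹
  have hai : a * v i = t := inv_mul_cancel_right₀ hi t
  refine ⟨fun j => Algebra.trace k L (a * v j), i, by simp only [hai, ht], ?_⟩
  refine translate_eq_C_of_map (algebraMap k L).injective ?_
  have hw : algebraMap k L ∘ (fun j => Algebra.trace k L (a * v j)) =
      ∑ s : Gal(L/k), (s : L →+* L) ∘ (a • v) := by
    ext j
    simp [trace_eq_sum_automorphisms]
  rw [hw]
  refine translate_sum _ fun s _ => ?_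
  have hs : MvPolynomial.map (algebraMap k L) f =
      MvPolynomial.map (s : L →+* L) (MvPolynomial.map (algebraMap k L) f) := by
    rw [MvPolynomial.map_map]
    congr 2
    ext x
    simp
  have hinv : translate (a • v) (MvPolynomial.map (algebraMap k L) f) =
      Polynomial.C (MvPolynomial.map (algebraMap k L) f) := by
    refine translate_eq_C_of_dvd (pow_ne_zero N h0) ?_ hdvd
    rw [map_pow, map_prod, Finset.prod_congr rfl fun j _ =>
      translate_eq_C_of_isHomogeneous_one (hh j) (hvh a j), ← map_prod, ← map_pow]
  rw [hs, translate_map, hinv, Polynomial.map_C]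

/-- Homogeneous Nullstellensatz for hypersurfaces. A prime containing `f` may be replaced by its
homogeneous core, which is either a point of `ℙⁿ` or contains the irrelevant ideal, and so `g`. -/
lemma exists_dvd_pow_of_vanishingSet_subset {K : Type u} [Field K] {n d e : ℕ} (hd : 0 < d)
    {f g : MvPolynomial (Fin (n + 1)) K} (hf : f.IsHomogeneous e) (hg : g.IsHomogeneous d)
    (h : vanishingSet f ⊆ vanishingSet g) : ∃ N : ℕ, f ∣ g ^ N := by
  suffices hr : g ∈ (Ideal.span {f}).radical by
    obtain ⟨N, hN⟩ := hr
    exact ⟨N, Ideal.mem_span_singleton.mp hN⟩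
  rw [Ideal.radical_eq_sInf, Submodule.mem_sInf]
  rintro J ⟨hfJ, hJ⟩
  refine Ideal.toIdeal_homogeneousCore_le (grading K n) J ?_
  by_cases hirr : HomogeneousIdeal.irrelevant (grading K n) ≤
      Ideal.homogeneousCore (grading K n) J
  · exact hirr (HomogeneousIdeal.mem_irrelevant_of_mem (grading K n) hd hg)
  · let x : Proj (grading K n) := ⟨_, hJ.homogeneousCore, hirr⟩
    have hx : x ∈ vanishingSet f := Ideal.mem_homogeneousCore_of_homogeneous_of_mem ⟨e, hf⟩
      (hfJ (Ideal.mem_span_singleton_self f))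
    exact h hx

/-- Only the zero polynomial vanishes at the generic point of `ℙⁿ`. -/
lemma eq_zero_of_vanishingSet_subset {K : Type u} [Field K] {n : ℕ}
    {f : MvPolynomial (Fin (n + 1)) K} (h : vanishingSet (0 : MvPolynomial (Fin (n + 1)) K) ⊆
      vanishingSet f) : f = 0 := by
  let x : Proj (grading K n) := ⟨⊥, Ideal.isPrime_bot, fun hle =>
    MvPolynomial.X_ne_zero (R := K) (0 : Fin (n + 1)) (hle (HomogeneousIdeal.mem_irrelevant_of_mem
      (grading K n) one_pos (MvPolynomial.isHomogeneous_X K 0)))⟩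
  have hx : x ∈ vanishingSet (0 : MvPolynomial (Fin (n + 1)) K) :=
    (⊥ : Ideal (MvPolynomial (Fin (n + 1)) K)).zero_mem
  exact h hx

/-- The preimage of `V(f)` under base change is `V(f)` over the larger field. -/
lemma projBaseChange_preimage_vanishingSet (k L : Type u) [Field k] [Field L] [Algebra k L]
    (n : ℕ) (f : MvPolynomial (Fin (n + 1)) k) :
    projBaseChange k L n ⁻¹' vanishingSet f =
      vanishingSet (MvPolynomial.map (algebraMap k L) f) :=
  rfl

end Hyperplanes

end KZeroVar

theorem theorem5p3 {k L : Type u} [Field k] [Field L] [Algebra k L]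
    [FiniteDimensional k L] [IsGalois k L] (n d : ℕ) (hd : 1 ≤ d) (hdn : d ≤ n)
    (X : Variety k) (i : X.obj ⟶ projSpace k n) (hi : IsClosedImmersion i.left)
    (f : MvPolynomial (Fin (n + 1)) k) (hf : f ≠ 0) (hfd : f.IsHomogeneous d)
    (hX : Set.range i.left = vanishingSet f)
    (h : Fin d → MvPolynomial (Fin (n + 1)) L) (hh : ∀ j, (h j).IsHomogeneous 1)
    (hXL : Set.range (pullback.snd i.left (projBaseChange k L n)) = vanishingSet (∏ j, h j)) :
    cls X - 1 ∈ Ideal.span {lefschetz k} ∧ Nonempty (RationalPoints X) := by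
  have hV : vanishingSet (MvPolynomial.map (algebraMap k L) f) = vanishingSet (∏ j, h j) := by
    rw [← hXL, Scheme.Pullback.range_snd, hX, projBaseChange_preimage_vanishingSet]
  have h0 : ∏ j, h j ≠ 0 := fun h0 => hf <| by
    rw [h0] at hV
    have := eq_zero_of_vanishingSet_subset hV.ge
    exact (map_eq_zero_iff _ (MvPolynomial.map_injective _ (algebraMap k L).injective)).mp this
  have hg : (∏ j, h j).IsHomogeneous d := by
    simpa using MvPolynomial.IsHomogeneous.prod Finset.univ h (fun _ => 1) fun j _ => hh j
  obtain ⟨N, hN⟩ := exists_dvd_pow_of_vanishingSet_subset hd (hfd.map _) hg hV.le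
  obtain ⟨w, i₀, hw, hwf⟩ := exists_translate_eq_C hdn f h hh h0 N hN
  obtain ⟨c, F, hF⟩ := exists_coordChange hw hwf
  rw [Ideal.mem_span_singleton]
  refine c.lefschetz_dvd_cls_sub_one hd hfd hF (Nat.zero_le n) X i ?_
  rw [hX]
  ext x
  refine ⟨?_, fun hx => hx f (Or.inl rfl)⟩
  rintro hx g (rfl | ⟨j, hj, -⟩)
  · exact hx
  · exact absurd hj (Nat.not_lt_zero _)
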